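/- A finite hypergraph $\mathcal H=(\mathcal V,\mathcal E)$ consists of a finite set $\mathcal V$ and a set $\mathcal E$ of subsets of $\mathcal V$ (the edges). It is $3$-uniform if $|e|=3$ for every $e\in\mathcal E$, and linear if $|e\cap f|\le 1$ for all distinct $e,f\in\mathcal E$; a vertex is isolated if it lies in no edge. A transversal is a set of vertices that meets every edge, and $\tau(\mathcal H)$ is the minimum cardinality of a transversal; a matching is a set of pairwise disjoint edges, and $\nu(\mathcal H)$ is the maximum cardinality of a matching. Theorem. There is a polynomial-time algorithm (a fixed program for a deterministic unit-cost random access machine with addition and truncated subtraction, together with a polynomial $p$ such that it halts within $p(|\mathcal V|+|\mathcal E|)$ steps on the inputs described next) with the following property. Let $\mathcal H=(\mathcal V,\mathcal E)$ be a finite linear $3$-uniform hypergraph without isolated vertices and with $\mathcal E\ne\emptyset$, and suppose that at least one of the following holds: (i) $\nu(\mathcal H)/|\mathcal E|\ge \tfrac13$; (ii) $|\mathcal V|/|\mathcal E|\ge 2$. Then, given $\mathcal H$ as a list of its edges (as triples of vertices, under any numbering $0,\dots,|\mathcal V|-1$ of the vertices and in any order), the algorithm outputs a transversal of $\mathcal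 H$ of cardinality at most $2\nu(\mathcal H)$. In particular, $\tau(\mathcal H)\le 2\nu(\mathcal H)$. -/

import Mathlib

universe u

open scoped Hypergraph

namespace Hypergraph

variable {α : Type*}

/-- Every edge has exactly `k` vertices. -/
def IsUniform (H : Hypergraph α) (k : ℕ) : Prop :=
  ∀ e ∈ E(H), e.encard = k

/-- Any two distinct edges share at most one vertex. -/
def IsLinear (H : Hypergraph α) : Prop :=
  ∀ e ∈ E(H), ∀ f ∈ E(H), e ≠ f → (e ∩ f).encard ≤ 1

/-- A transversal: a set of vertices that meets every edge. -/
def IsTransversal (H : Hypergraph α) (T : Set α) : Prop :=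
  T ⊆ V(H) ∧ ∀ e ∈ E(H), (T ∩ e).Nonempty

/-- A matching: a set of pairwise disjoint edges. -/
def IsMatching (H : Hypergraph α) (M : Set (Set α)) : Prop :=
  M ⊆ E(H) ∧ M.Pairwise Disjoint

/-- `τ(H)`, the minimum cardinality of a transversal of a hypergraph on a finite vertex set. -/
noncomputable def transversalNumber (H : Hypergraph α) : ℕ :=
  sInf {k | ∃ T : Set α, H.IsTransversal T ∧ T.ncard = k}

/-- `ν(H)`, the maximum cardinality of a matching of a hypergraph on a finite vertex set. -/
noncomputable def matchingNumber (H : Hypergraph α) : ℕ :=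
  sSup {k | ∃ M : Set (Set α), H.IsMatching M ∧ M.ncard = k}

/-- `lab` numbers the vertices of `H` as `0, …, n - 1`, each vertex once, and `e` lists the edges
of `H`, each edge once, as triples of vertex numbers. The numbering, the order of the edges and
the order of the vertices inside a triple are arbitrary. -/
structure IsPresentation (H : Hypergraph α) {n m : ℕ} (lab : Fin n → α)
    (e : Fin m → Fin 3 → Fin n) : Prop where
  lab_injective : Function.Injective lab
  range_lab : Set.range lab = V(H)
  edge_injective : Function.Injective fun i => lab '' Set.range (e i)
  range_edge : (Set.range fun i => lab '' Set.range (e i)) = E(H)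

end Hypergraph

/-! Random access machines (in structured form) with unit cost. The only arithmetic operations
are addition and truncated subtraction, so that computing in polynomial time on such a machine is
the same as computing in polynomial time on a Turing machine. -/

namespace RAM

/-- The memory: registers, and arrays with indirect access. Registers, arrays and array cells are
numbered by natural numbers; a program mentions only finitely many registers and arrays. -/
@[ext]
structure State where
  reg : ℕ → ℕ
  arr : ℕ → ℕ → ℕ

namespace State

/-- The state after `reg x := v`. -/
def setReg (s : State) (x v : ℕ) : State where
  reg := Function.update s.reg x v
  arr := s.arr

/-- The state after `arr a [i] := v`. -/
def setArr (s : State) (a i v : ℕ) : State where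
  reg := s.reg
  arr := Function.update s.arr a (Function.update (s.arr a) i v)

end State

/-- Elementary instructions. -/
inductive Instr : Type
  /-- `reg x := c` for a constant `c` -/
  | const (x c : ℕ)
  /-- `reg x := reg y + reg z` -/
  | add (x y z : ℕ)
  /-- `reg x := max (reg y - reg z) 0` -/
  | sub (x y z : ℕ)
  /-- `reg x := arr a [reg y]` -/
  | load (x a y : ℕ)
  /-- `arr a [reg y] := reg x` -/
  | store (a y x : ℕ)

/-- The effect of an instruction on the memory. -/
def Instr.exec : Instr → State → State
  | .const x c, s => s.setReg x c
  | .add x y z, s => s.setReg x (s.reg y + s.reg z)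
  | .sub x y z, s => s.setReg x (s.reg y - s.reg z)
  | .load x a y, s => s.setReg x (s.arr a (s.reg y))
  | .store a y x, s => s.setArr a (s.reg y) (s.reg x)

/-- Programs. -/
inductive Prog : Type
  | skip
  | instr (i : Instr)
  | seq (P Q : Prog)
  /-- if `reg x < reg y` then `P` else `Q` -/
  | ifLt (x y : ℕ) (P Q : Prog)
  /-- while `reg x < reg y` do `P` -/
  | whileLt (x y : ℕ) (P : Prog)

/-- `Exec P s t s'`: started in the memory state `s`, the program `P` halts in the memory state
`s'` after exactly `t` steps, where each elementary instruction and each evaluation of a test is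
one step. -/
inductive Exec : Prog → State → ℕ → State → Prop
  | skip (s : State) : Exec .skip s 1 s
  | instr (i : Instr) (s : State) : Exec (.instr i) s 1 (i.exec s)
  | seq {P Q : Prog} {s s' s'' : State} {t t' : ℕ} :
      Exec P s t s' → Exec Q s' t' s'' → Exec (.seq P Q) s (t + t') s''
  | ifTrue {x y : ℕ} {P Q : Prog} {s s' : State} {t : ℕ} :
      s.reg x < s.reg y → Exec P s t s' → Exec (.ifLt x y P Q) s (1 + t) s'
  | ifFalse {x y : ℕ} {P Q : Prog} {s s' : State} {t : ℕ} :
      ¬ s.reg x < s.reg y → Exec Q s t s' → Exec (.ifLt x y P Q) s (1 + t) s'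
  | whileTrue {x y : ℕ} {P : Prog} {s s' s'' : State} {t t' : ℕ} :
      s.reg x < s.reg y → Exec P s t s' → Exec (.whileLt x y P) s' t' s'' →
        Exec (.whileLt x y P) s (1 + t + t') s''
  | whileFalse {x y : ℕ} {P : Prog} {s : State} :
      ¬ s.reg x < s.reg y → Exec (.whileLt x y P) s 1 s

/-- The machine is deterministic: the final state and the number of steps are determined by the
program and the initial state. -/
theorem Exec.deterministic {P : Prog} {s s₁ s₂ : State} {t₁ t₂ : ℕ}
    (h₁ : Exec P s t₁ s₁) (h₂ : Exec P s t₂ s₂) : t₁ = t₂ ∧ s₁ = s₂ := by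
  induction h₁ generalizing t₂ s₂ with
  | skip s => cases h₂; exact ⟨rfl, rfl⟩
  | instr i s => cases h₂; exact ⟨rfl, rfl⟩
  | seq _ _ ihP ihQ =>
    cases h₂ with
    | seq hP hQ =>
      obtain ⟨rfl, rfl⟩ := ihP hP
      obtain ⟨rfl, rfl⟩ := ihQ hQ
      exact ⟨rfl, rfl⟩
  | ifTrue hlt _ ih =>
    cases h₂ with
    | ifTrue _ h => obtain ⟨rfl, rfl⟩ := ih h; exact ⟨rfl, rfl⟩
    | ifFalse hn _ => exact absurd hlt hn
  | ifFalse hn _ ih =>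
    cases h₂ with
    | ifTrue hlt _ => exact absurd hlt hn
    | ifFalse _ h => obtain ⟨rfl, rfl⟩ := ih h; exact ⟨rfl, rfl⟩
  | whileTrue hlt _ _ ihP ihW =>
    cases h₂ with
    | whileTrue _ hP hW =>
      obtain ⟨rfl, rfl⟩ := ihP hP
      obtain ⟨rfl, rfl⟩ := ihW hW
      exact ⟨rfl, rfl⟩
    | whileFalse hn => exact absurd hlt hn
  | whileFalse hn =>
    cases h₂ with
    | whileTrue hlt _ _ => exact absurd hlt hn
    | whileFalse _ => exact ⟨rfl, rfl⟩

/-- The initial memory on input `e`, a list of `m` triples of numbers below `n`: register `0`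
holds `n`, register `1` holds `m`, cell `3 * i + j` of array `0` holds `e i j` for `i < m` and
`j < 3`, and everything else is `0`. -/
def inputState {n m : ℕ} (e : Fin m → Fin 3 → Fin n) : State where
  reg x := if x = 0 then n else if x = 1 then m else 0
  arr a k :=
    if h : a = 0 ∧ k < 3 * m then
      (e ⟨k / 3, Nat.div_lt_of_lt_mul h.2⟩ ⟨k % 3, Nat.mod_lt k (by norm_num)⟩ : ℕ)
    else 0

/-- The set of numbers below `n` that the final memory `s` describes: `v` belongs to it when
cell `v` of array `1` is nonzero. -/
def outputSet (n : ℕ) (s : State) : Set (Fin n) :=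
  {v | s.arr 1 v ≠ 0}

end RAM

/-!
The algorithm goes three times through all vertices, with the thresholds `k = 3, 2, 1`, and adds a
vertex to the transversal when it lies on at least `k` edges that are not met yet. Degrees in the
hypergraph of the unmet edges never increase, so they are below `k` after the pass with threshold
`k`, and in the end every edge is met. Counting takes `O(|V| |E|)` steps altogether. Both conditions
of the theorem force this one transversal to have at most `2ν` elements.

*Many edges in a matching* (`card_greedy_le_of_card_le`). Let the first two passes add `a` and `b`
vertices, and let `w` and `u` be the numbers of edges that are unmet after them. The third pass adds
at most `u` vertices, `3a + w ≤ |E|`, and `2b + u ≤ w`. After the first pass the intersection graph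
of the unmet edges is subcubic, and the second pass picks a maximal matching of it. The point is that
there is an independent set of size at least `w/6 + u/2` (`exists_isIndepSet_of_even_sdiff`); this is
at most `ν`, and with `ν ≥ |E|/3` it gives `2ν ≥ a + w/2 + u/2 ≥ a + b + u`. If the independence number
is at least `w/3`, then it is large enough, as the `u` vertices that the matching misses are
independent. Brooks' theorem would give `w/3` except for components `K₄`, but is not needed: a greedy
choice loses at most `1/3` in a cubic component, and that loss is compensated because the number of
vertices of a cubic graph is even, as is the number of those that the matching covers.

*Many vertices* (`card_greedy_le_of_two_mul_le`). Consider `2|E'| - |V'|` for the hypergraph of the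
unmet edges and the vertices on them. Adding a vertex of degree `d` removes `d` edges. If each of
them has another vertex that remains, then at most `1 + d` vertices are lost, so that
`2|E'| - |V'|` drops by at least `d - 1`. Otherwise one of the edges is disjoint from all the edges
that remain, and it is added to a matching, while `2|E'| - |V'|` increases by at most 1. As it is at
most 0 in the beginning and 0 in the end, steps of the first kind are at most as numerous as those of
the second, if `d ≥ 2` in them. In the third pass all steps are of the second kind.
-/

/-! ### Independent sets in subcubic graphs -/

namespace SimpleGraph

open Classical in
/-- One step of a greedy construction of independent sets: the vertex `v` is added to an independent
set `I` of what remains of `S` without the closed neighbourhood of `v`. -/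
lemma exists_isIndepSet_of_remove_neighbors {ι : Type*} (G : SimpleGraph ι) {S : Finset ι} {v : ι}
    (hv : v ∈ S)
    (h : ∃ I ⊆ S.filter (fun j => j ≠ v ∧ ¬ G.Adj v j), G.IsIndepSet (I : Set ι) ∧
      (S.filter (fun j => j ≠ v ∧ ¬ G.Adj v j)).card ≤ 3 * I.card) :
    ∃ I ⊆ S, G.IsIndepSet (I : Set ι) ∧
      S.card + 2 ≤ 3 * I.card + (S.filter (G.Adj v)).card := by
  obtain ⟨I, hIS, hI, hc⟩ := h
  have hvI : v ∉ I := fun hm => by simpa using hIS hm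
  refine ⟨insert v I, Finset.insert_subset hv (hIS.trans (Finset.filter_subset _ _)), ?_, ?_⟩
  · rw [Finset.coe_insert]
    have : Std.Symm fun a b => ¬ G.Adj a b := ⟨fun a b hab hba => hab hba.symm⟩
    refine Set.pairwise_insert_of_symm.2 ⟨hI, ?_⟩
    intro b hb _
    exact (Finset.mem_filter.1 (hIS hb)).2.2
  · have hle : S.card ≤
        (S.filter (fun j => j ≠ v ∧ ¬ G.Adj v j)).card + (1 + (S.filter (G.Adj v)).card) := by
      have hsub : S ⊆ S.filter (fun j => j ≠ v ∧ ¬ G.Adj v j) ∪ ({v} ∪ S.filter (G.Adj v)) := by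
        intro j hj
        simp only [Finset.mem_union, Finset.mem_filter, Finset.mem_singleton]
        tauto
      refine (Finset.card_le_card hsub).trans ((Finset.card_union_le _ _).trans ?_)
      gcongr
      exact (Finset.card_union_le _ _).trans (by simp)
    rw [Finset.card_insert_of_notMem hvI]
    omega

open Classical in
/-- A 2-degenerate graph has an independent set that contains a third of the vertices. -/
lemma exists_isIndepSet_of_degenerate {ι : Type*} (G : SimpleGraph ι) (S : Finset ι)
    (h : ∀ C ⊆ S, C.Nonempty → ∃ v ∈ C, (C.filter (G.Adj v)).card ≤ 2) :
    ∃ I ⊆ S, G.IsIndepSet (I : Set ι) ∧ S.card ≤ 3 * I.card := by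
  induction S using Finset.strongInduction with
  | H S ih =>
    rcases S.eq_empty_or_nonempty with rfl | hne
    · exact ⟨∅, by simp⟩
    obtain ⟨v, hv, hdeg⟩ := h S subset_rfl hne
    have hss : S.filter (fun j => j ≠ v ∧ ¬ G.Adj v j) ⊂ S :=
      Finset.filter_ssubset.2 ⟨v, hv, by simp⟩
    obtain ⟨I, hIS, hI, hc⟩ := G.exists_isIndepSet_of_remove_neighbors hv
      (ih _ hss fun C hC => h C (hC.trans hss.subset))
    exact ⟨I, hIS, hI, by omega⟩

open Classical in
/-- The handshake lemma for a cubic induced subgraph. -/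
lemma even_card_of_cubic {ι : Type*} (G : SimpleGraph ι) (C : Finset ι)
    (h : ∀ v ∈ C, (C.filter (G.Adj v)).card = 3) : Even C.card := by
  have h1 : ((C ×ˢ C).filter (fun p => G.Adj p.1 p.2)).card = 3 * C.card := by
    rw [Finset.card_filter, Finset.sum_product]
    simp_rw [← Finset.card_filter]
    rw [Finset.sum_congr rfl h]
    simp [mul_comm]
  have h2 : ∑ p ∈ (C ×ˢ C).filter (fun p => G.Adj p.1 p.2), (1 : ZMod 2) = 0 := by
    refine Finset.sum_involution (fun p _ => p.swap) (fun _ _ => by decide) ?_ ?_ ?_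
    · rintro ⟨a, b⟩ hp _ heq
      simp only [Finset.mem_filter, Prod.swap_prod_mk, Prod.mk.injEq] at hp heq
      exact G.ne_of_adj hp.2 heq.2
    · rintro ⟨a, b⟩ hp
      simp only [Finset.mem_filter, Finset.mem_product, Prod.swap_prod_mk] at hp ⊢
      exact ⟨⟨hp.1.2, hp.1.1⟩, hp.2.symm⟩
    · rintro ⟨a, b⟩ _
      rfl
  rw [Finset.sum_const, nsmul_one, h1, ZMod.natCast_eq_zero_iff_even] at h2
  exact (Nat.even_mul.1 h2).resolve_left (by decide)

open Classical in
/-- In the application `W \ U` is covered by a matching of the graph, and `U` is the set of vertices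
that the matching misses. The only consequence of this that matters is that the matching covers an
even number of vertices in every union of components. -/
lemma exists_isIndepSet_of_even_sdiff {ι : Type*} (G : SimpleGraph ι) (W U : Finset ι)
    (hdeg : ∀ v ∈ W, (W.filter (G.Adj v)).card ≤ 3) (hUW : U ⊆ W) (hU : G.IsIndepSet (U : Set ι))
    (heven : ∀ C ⊆ W, (∀ i ∈ C, ∀ j ∈ W, G.Adj i j → j ∈ C) → Even (C \ U).card) :
    ∃ I ⊆ W, G.IsIndepSet (I : Set ι) ∧ 3 * U.card + W.card ≤ 6 * I.card := by
  induction W using Finset.strongInduction generalizing U with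
  | H W ih =>
    let Q : Finset ι → Prop := fun C => C.Nonempty ∧ ∀ v ∈ C, 3 ≤ (C.filter (G.Adj v)).card
    by_cases hex : ∃ C ⊆ W, Q C
    swap
    · -- The larger of `U` and the independent set of the degenerate graph will do.
      obtain ⟨I, hIW, hI, hc⟩ := G.exists_isIndepSet_of_degenerate W (by
        intro C hC hne
        by_contra! hcon
        exact hex ⟨C, hC, hne, hcon⟩)
      rcases le_total U.card I.card with hle | hle
      · exact ⟨I, hIW, hI, by omega⟩
      · exact ⟨U, hUW, hU, by omega⟩
    obtain ⟨C, hC, hmin⟩ := Finset.exists_min_image (W.powerset.filter Q) Finset.card (by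
      obtain ⟨C, hC, hQ⟩ := hex
      exact ⟨C, by simp [hC, hQ]⟩)
    obtain ⟨hCW, ⟨v, hv⟩, hC3⟩ : C ⊆ W ∧ Q C := by simpa using hC
    have hCeq : ∀ i ∈ C, C.filter (G.Adj i) = W.filter (G.Adj i) := fun i hi =>
      Finset.eq_of_subset_of_card_le (Finset.filter_subset_filter _ hCW)
        ((hdeg i (hCW hi)).trans (hC3 i hi))
    have hclosed : ∀ i ∈ C, ∀ j ∈ W, G.Adj i j → j ∈ C := fun i hi j hj hij => by
      have : j ∈ C.filter (G.Adj i) := by rw [hCeq i hi]; simp [hj, hij]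
      exact (Finset.mem_filter.1 this).1
    have hcub : ∀ i ∈ C, (C.filter (G.Adj i)).card = 3 := fun i hi =>
      le_antisymm (by rw [hCeq i hi]; exact hdeg i (hCW hi)) (hC3 i hi)
    -- By minimality of `C`, what remains of it after the closed neighbourhood of `v` is removed is
    -- 2-degenerate.
    have hss : C.filter (fun j => j ≠ v ∧ ¬ G.Adj v j) ⊂ C :=
      Finset.filter_ssubset.2 ⟨v, hv, by simp⟩
    obtain ⟨J, hJC, hJ, hJc⟩ := G.exists_isIndepSet_of_remove_neighbors hv
      (G.exists_isIndepSet_of_degenerate _ (by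
        intro D hD hne
        by_contra! hcon
        have hDC := (Finset.card_lt_card (Finset.ssubset_of_subset_of_ssubset hD hss))
        have := hmin D (by
          simp only [Finset.mem_filter, Finset.mem_powerset]
          exact ⟨(hD.trans hss.subset).trans hCW, hne, hcon⟩)
        omega))
    rw [hcub v hv] at hJc
    -- Here `3 * J.card ≥ C.card - 1`. If equality holds, then `J.card` is odd because `C.card` is even,
    -- while `(U ∩ C).card` is even, so that the two differ, which makes up for the lost `1`.
    obtain ⟨I₁, hI₁C, hI₁, hc₁⟩ :
        ∃ I ⊆ C, G.IsIndepSet (I : Set ι) ∧ 3 * (U ∩ C).card + C.card ≤ 6 * I.card := by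
      obtain ⟨x, hx⟩ := G.even_card_of_cubic C hcub
      obtain ⟨y, hy⟩ := heven C hCW hclosed
      have hsum := Finset.card_sdiff_add_card_inter C U
      rw [Finset.inter_comm] at hsum
      rcases le_total (U ∩ C).card J.card with hle | hle
      · exact ⟨J, hJC, hJ, by omega⟩
      · exact ⟨U ∩ C, Finset.inter_subset_right, hU.mono (by simp), by omega⟩
    have hWC : W \ C ⊂ W := Finset.sdiff_ssubset hCW ⟨v, hv⟩
    obtain ⟨I₂, hI₂W, hI₂, hc₂⟩ := ih (W \ C) hWC (U \ C)
      (fun i hi => (Finset.card_le_card (Finset.filter_subset_filter _ hWC.subset)).trans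
        (hdeg i (hWC.subset hi)))
      (Finset.sdiff_subset_sdiff hUW subset_rfl) (hU.mono (by simp)) (by
        intro D hD hDcl
        have heq : D \ (U \ C) = D \ U := by
          ext j
          have := @hD j
          simp only [Finset.mem_sdiff] at this ⊢
          tauto
        rw [heq]
        refine heven D (hD.trans hWC.subset) fun i hi j hj hij => ?_
        have hiD := Finset.mem_sdiff.1 (hD hi)
        exact hDcl i hi j (Finset.mem_sdiff.2
          ⟨hj, fun hjC => hiD.2 (hclosed j hjC i hiD.1 hij.symm)⟩) hij)
    have hdisj : Disjoint I₁ I₂ := Finset.disjoint_left.2 fun j h1 h2 =>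
      (Finset.mem_sdiff.1 (hI₂W h2)).2 (hI₁C h1)
    refine ⟨I₁ ∪ I₂, Finset.union_subset (hI₁C.trans hCW) (hI₂W.trans hWC.subset), ?_, ?_⟩
    · rw [Finset.coe_union]
      have : Std.Symm fun a b => ¬ G.Adj a b := ⟨fun a b hab hba => hab hba.symm⟩
      refine Set.pairwise_union_of_symm.2
        ⟨hI₁, hI₂, fun i hi j hj _ hij => ?_⟩
      have hj' := Finset.mem_sdiff.1 (hI₂W hj)
      exact hj'.2 (hclosed i (hI₁C hi) j hj'.1 hij)
    · rw [Finset.card_union_of_disjoint hdisj]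
      have h1 := Finset.card_sdiff_add_card_inter U C
      have h2 := Finset.card_sdiff_add_card_eq_card hCW
      omega

end SimpleGraph

/-! ### Intersection graphs -/

namespace GreedyTransversal

variable {ι β : Type*}

/-- The intersection graph of a family of sets. -/
def interGraph (F : ι → Finset β) : SimpleGraph ι where
  Adj i j := i ≠ j ∧ ¬ Disjoint (F i) (F j)
  symm := ⟨fun _ _ h => ⟨h.1.symm, fun hd => h.2 hd.symm⟩⟩
  loopless := ⟨fun _ h => h.1 rfl⟩

lemma disjoint_of_isIndepSet {F : ι → Finset β} {I : Finset ι}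
    (hI : (interGraph F).IsIndepSet (I : Set ι)) :
    (I : Set ι).Pairwise fun i j => Disjoint (F i) (F j) := fun i hi j hj hij => by
  by_contra h
  exact hI hi hj hij ⟨hij, h⟩

/-! ### Greedy passes -/

variable [Fintype ι]

open Classical in
/-- The (indices of the) edges of the family `F` that `T` does not meet. -/
noncomputable def alive (F : ι → Finset β) (T : Finset β) : Finset ι :=
  Finset.univ.filter fun i => Disjoint (F i) T

open Classical in
/-- The degree of `v` in the hypergraph of the edges that `T` does not meet. -/
noncomputable def liveDeg (F : ι → Finset β) (T : Finset β) (v : β) : ℕ :=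
  ((alive F T).filter fun i => v ∈ F i).card

open Classical in
/-- Add `v` to `T` if it meets at least `k` edges that `T` does not meet. -/
noncomputable def greedyStep (F : ι → Finset β) (k : ℕ) (T : Finset β) (v : β) : Finset β :=
  if k ≤ liveDeg F T v then insert v T else T

/-- Carry out `greedyStep` for all vertices of the list `l` in turn. -/
noncomputable def greedyPass (F : ι → Finset β) (k : ℕ) (l : List β) (T : Finset β) : Finset β :=
  l.foldl (greedyStep F k) T

/-- The greedy transversal: passes with the thresholds 3, 2 and 1. -/
noncomputable def greedy (F : ι → Finset β) (l : List β) : Finset β :=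
  greedyPass F 1 l (greedyPass F 2 l (greedyPass F 3 l ∅))

variable {F : ι → Finset β} {T T' : Finset β} {k : ℕ} {v : β} {l : List β}

@[simp] lemma mem_alive {i : ι} : i ∈ alive F T ↔ Disjoint (F i) T := by simp [alive]

@[simp] lemma alive_empty : alive F ∅ = Finset.univ := by ext; simp

lemma alive_anti (h : T ⊆ T') : alive F T' ⊆ alive F T := fun i hi => by
  rw [mem_alive] at hi ⊢
  exact hi.mono_right h

open Classical in
lemma liveDeg_anti (h : T ⊆ T') : liveDeg F T' v ≤ liveDeg F T v :=
  Finset.card_le_card (Finset.filter_subset_filter _ (alive_anti h))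

open Classical in
lemma alive_insert :
    alive F (insert v T) = (alive F T).filter fun i => v ∉ F i := by
  ext i
  simp [and_comm]

open Classical in
lemma card_alive_insert :
    (alive F (insert v T)).card + liveDeg F T v = (alive F T).card := by
  rw [alive_insert, liveDeg, add_comm]
  exact Finset.card_filter_add_card_filter_not _

open Classical in
lemma subset_greedyStep : T ⊆ greedyStep F k T v := by
  unfold greedyStep
  split_ifs
  · exact Finset.subset_insert _ _
  · exact subset_rfl

lemma subset_greedyPass : T ⊆ greedyPass F k l T := by
  induction l generalizing T with
  | nil => exact subset_rfl
  | cons v l ih => exact subset_greedyStep.trans ih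

open Classical in
/-- Degrees never increase, so that after a pass with threshold `k` all degrees are below `k`. -/
lemma liveDeg_greedyPass_lt (hk : 0 < k) (hv : v ∈ l) : liveDeg F (greedyPass F k l T) v < k := by
  induction l generalizing T with
  | nil => simp at hv
  | cons w l ih =>
    rcases List.mem_cons.1 hv with rfl | hv
    · refine (liveDeg_anti (subset_greedyPass (F := F) (l := l) (k := k))).trans_lt ?_
      unfold greedyStep
      split_ifs with h
      · have : liveDeg F (insert v T) v = 0 := by
          rw [liveDeg, alive_insert, Finset.filter_filter]
          simp
        omega
      · omega
    · exact ih hv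

open Classical in
/-- What is preserved whenever a vertex of degree at least `k` is added is preserved by a pass. -/
lemma greedyPass_induction {Q : Finset β → Prop} (h0 : Q T)
    (h : ∀ T v, Q T → k ≤ liveDeg F T v → Q (insert v T)) : Q (greedyPass F k l T) := by
  induction l generalizing T with
  | nil => exact h0
  | cons v l ih =>
    refine ih ?_
    unfold greedyStep
    split_ifs with hv
    · exact h T v h0 hv
    · exact h0

lemma card_greedyPass :
    k * (greedyPass F k l T).card + (alive F (greedyPass F k l T)).card ≤
      k * T.card + (alive F T).card := by
  classical
  refine greedyPass_induction (Q := fun S => k * S.card + (alive F S).card ≤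
    k * T.card + (alive F T).card) le_rfl fun S v hS hv => ?_
  have h1 := card_alive_insert (F := F) (v := v) (T := S)
  have h2 := Nat.mul_le_mul_left k (Finset.card_insert_le v S)
  rw [mul_add, mul_one] at h2
  omega

open Classical in
/-- Every edge is met at the end, because after the pass with threshold 1 all degrees are 0. -/
lemma not_disjoint_greedy (hl : ∀ v, v ∈ l) (hne : ∀ i, (F i).Nonempty) (i : ι) :
    ¬ Disjoint (F i) (greedy F l) := by
  intro hi
  obtain ⟨v, hv⟩ := hne i
  have h := liveDeg_greedyPass_lt (F := F) (T := greedyPass F 2 l (greedyPass F 3 l ∅))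
    one_pos (hl v)
  rw [Nat.lt_one_iff, liveDeg, Finset.card_eq_zero, Finset.filter_eq_empty_iff] at h
  exact h (mem_alive.2 hi) hv

/-! ### Few edges: the intersection graph -/

open Classical in
/-- If every vertex has degree at most 2, then an edge meets at most one other edge in each of its
vertices. -/
lemma card_interGraph_le (hF : ∀ i, (F i).card ≤ 3) (hT : ∀ v, liveDeg F T v ≤ 2) {i : ι}
    (hi : i ∈ alive F T) : ((alive F T).filter ((interGraph F).Adj i)).card ≤ 3 := by
  have hsub : (alive F T).filter ((interGraph F).Adj i) ⊆
      (F i).biUnion fun v => ((alive F T).filter fun j => v ∈ F j).erase i := by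
    intro j hj
    obtain ⟨hjT, hij, hd⟩ := Finset.mem_filter.1 hj
    obtain ⟨v, hvi, hvj⟩ := Finset.not_disjoint_iff.1 hd
    exact Finset.mem_biUnion.2 ⟨v, hvi, by simp [hij.symm, hvj, mem_alive.1 hjT]⟩
  refine (Finset.card_le_card hsub).trans ?_
  refine (Finset.card_biUnion_le_card_mul _ _ 1 fun v hv => ?_).trans (by simpa using hF i)
  rw [Finset.card_erase_of_mem (by simp [hv, mem_alive.1 hi])]
  have := hT v
  rw [liveDeg] at this
  omega

lemma isIndepSet_alive (hT : ∀ v, liveDeg F T v ≤ 1) :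
    (interGraph F).IsIndepSet (alive F T : Set ι) := by
  classical
  intro i hi j hj hij hadj
  obtain ⟨v, hvi, hvj⟩ := Finset.not_disjoint_iff.1 hadj.2
  have h := Finset.card_le_one.1 (hT v)
  exact hij (h i (by simpa [hvi] using hi) j (by simpa [hvj] using hj))

open Classical in
/-- If all degrees are at most 2, the pass with threshold 2 removes the edges in intersecting pairs,
both of which lie in the same union of components of the intersection graph. -/
lemma even_sdiff_alive_greedyPass (hT : ∀ v, liveDeg F T v ≤ 2) {C : Finset ι}
    (hC : C ⊆ alive F T)
    (hcl : ∀ i ∈ C, ∀ j ∈ alive F T, (interGraph F).Adj i j → j ∈ C) :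
    Even (C \ alive F (greedyPass F 2 l T)).card := by
  refine (greedyPass_induction (F := F) (k := 2) (l := l) (T := T)
    (Q := fun S => T ⊆ S ∧ Even (C \ alive F S).card) ⟨subset_rfl, ?_⟩ ?_).2
  · rw [Finset.sdiff_eq_empty_iff_subset.2 hC]
    simp
  rintro S v ⟨hTS, hev⟩ hv
  refine ⟨hTS.trans (Finset.subset_insert _ _), ?_⟩
  have h2 : liveDeg F S v = 2 := le_antisymm ((liveDeg_anti hTS).trans (hT v)) hv
  obtain ⟨i, j, hij, hD⟩ := Finset.card_eq_two.1 h2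
  have hi : i ∈ alive F S ∧ v ∈ F i := Finset.mem_filter.1 (hD ▸ Finset.mem_insert_self i {j})
  have hj : j ∈ alive F S ∧ v ∈ F j :=
    Finset.mem_filter.1 (hD ▸ Finset.mem_insert_of_mem (Finset.mem_singleton_self j))
  have hadj : (interGraph F).Adj i j := ⟨hij, Finset.not_disjoint_iff.2 ⟨v, hi.2, hj.2⟩⟩
  have hiff : i ∈ C ↔ j ∈ C :=
    ⟨fun h => hcl i h j (alive_anti hTS hj.1) hadj,
      fun h => hcl j h i (alive_anti hTS hi.1) hadj.symm⟩
  have hdel : ∀ a, a ∈ alive F (insert v S) ↔ a ∈ alive F S ∧ a ≠ i ∧ a ≠ j := by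
    intro a
    have : a ∈ (alive F S).filter (fun i => v ∈ F i) ↔ a = i ∨ a = j := by rw [hD]; simp
    rw [Finset.mem_filter] at this
    rw [alive_insert, Finset.mem_filter]
    tauto
  by_cases hiC : i ∈ C
  · have heq : C \ alive F (insert v S) = insert i (insert j (C \ alive F S)) := by
      ext a
      have hjC := hiff.1 hiC
      simp only [Finset.mem_sdiff, Finset.mem_insert, hdel]
      constructor
      · tauto
      · rintro (rfl | rfl | h) <;> tauto
    rw [heq, Finset.card_insert_of_notMem (by simp [hij, mem_alive.1 hi.1]),
      Finset.card_insert_of_notMem (by simp [mem_alive.1 hj.1]), add_assoc]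
    exact hev.add (by decide)
  · have hjC := fun h => hiC (hiff.2 h)
    have heq : C \ alive F (insert v S) = C \ alive F S := by
      ext a
      simp only [Finset.mem_sdiff, hdel]
      constructor
      · rintro ⟨h1, h2⟩
        exact ⟨h1, fun h => h2 ⟨h, fun e => hiC (e ▸ h1), fun e => hjC (e ▸ h1)⟩⟩
      · tauto
    rwa [heq]

/-- The greedy transversal when a matching can contain a third of the edges. -/
lemma card_greedy_le_of_card_le (hl : ∀ v, v ∈ l) (hF : ∀ i, (F i).card ≤ 3)
    {N : ℕ} (hN : ∀ P : Finset ι, ((P : Set ι).Pairwise fun i j => Disjoint (F i) (F j)) →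
      P.card ≤ N) (hm : Fintype.card ι ≤ 3 * N) : (greedy F l).card ≤ 2 * N := by
  set T₁ := greedyPass F 3 l ∅ with hT₁
  set T₂ := greedyPass F 2 l T₁ with hT₂
  have h1 := card_greedyPass (F := F) (k := 3) (l := l) (T := ∅)
  have h2 := card_greedyPass (F := F) (k := 2) (l := l) (T := T₁)
  have h3 := card_greedyPass (F := F) (k := 1) (l := l) (T := T₂)
  rw [← hT₁, alive_empty, Finset.card_univ, Finset.card_empty] at h1
  rw [← hT₂] at h2
  have hd1 : ∀ v, liveDeg F T₁ v ≤ 2 := fun v =>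
    Nat.le_of_lt_succ (liveDeg_greedyPass_lt (by norm_num) (hl v))
  have hd2 : ∀ v, liveDeg F T₂ v ≤ 1 := fun v =>
    Nat.le_of_lt_succ (liveDeg_greedyPass_lt (by norm_num) (hl v))
  obtain ⟨I, -, hI, hIc⟩ := (interGraph F).exists_isIndepSet_of_even_sdiff (alive F T₁)
    (alive F T₂) (fun i hi => card_interGraph_le hF hd1 hi) (alive_anti subset_greedyPass)
    (isIndepSet_alive hd2) (fun C hC hcl => even_sdiff_alive_greedyPass hd1 hC hcl)
  have hIN := hN I (disjoint_of_isIndepSet hI)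
  -- If the first two passes add `a` and `b` vertices, then the third one adds at most the number `u`
  -- of edges left to it, and `12 * N ≥ 6 * a + 3 * w + 3 * u ≥ 6 * (a + b + u)`, where `w ≥ 2 * b + u`
  -- is the number of edges left to the second one.
  change (greedyPass F 1 l T₂).card ≤ 2 * N
  omega

/-! ### Many vertices: private vertices -/

open Classical in
/-- The vertices of the edges that `T` does not meet. -/
noncomputable def liveVerts [Fintype β] (F : ι → Finset β) (T : Finset β) : Finset β :=
  Finset.univ.filter fun v => ∃ i ∈ alive F T, v ∈ F i

/-- The invariant of the greedy passes in a hypergraph with many vertices: `P` is a matching of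
edges that are disjoint from all the edges that `T` does not meet. The inequality says that
`T.card` is at most `2 * P.card` as soon as `T` is a transversal. -/
def VertexInvariant [Fintype β] (F : ι → Finset β) (T : Finset β) : Prop :=
  ∃ P : Finset ι, ((P : Set ι).Pairwise fun i j => Disjoint (F i) (F j)) ∧
    (∀ i ∈ P, ∀ j ∈ alive F T, Disjoint (F i) (F j)) ∧
    T.card + 2 * (alive F T).card ≤ (liveVerts F T).card + 2 * P.card

open Classical in
/-- If each unmet edge at `v` has at most `c` vertices besides `v` that lie on no unmet edge avoiding
`v`, then adding `v` to `T` costs at most `c` vertices per edge at `v`, and `v` itself. -/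
lemma card_liveVerts_le [Fintype β] {c : ℕ}
    (h : ∀ i ∈ alive F T, v ∈ F i → ((F i).erase v \ liveVerts F (insert v T)).card ≤ c) :
    (liveVerts F T).card ≤ (liveVerts F (insert v T)).card + 1 + c * liveDeg F T v := by
  have hsub : liveVerts F T ⊆ (liveVerts F (insert v T) ∪ {v}) ∪
      ((alive F T).filter fun i => v ∈ F i).biUnion fun i =>
        (F i).erase v \ liveVerts F (insert v T) := by
    intro u hu
    obtain ⟨i, hi, hui⟩ := (Finset.mem_filter.1 hu).2
    by_cases hl : u ∈ liveVerts F (insert v T)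
    · simp [hl]
    by_cases huv : u = v
    · simp [huv]
    refine Finset.mem_union_right _ (Finset.mem_biUnion.2 ⟨i, ?_, by simp [hl, huv, hui]⟩)
    refine Finset.mem_filter.2 ⟨hi, ?_⟩
    by_contra hvi
    refine hl (Finset.mem_filter.2 ⟨Finset.mem_univ _, i, ?_, hui⟩)
    rw [alive_insert]
    exact Finset.mem_filter.2 ⟨hi, hvi⟩
  refine (Finset.card_le_card hsub).trans ((Finset.card_union_le _ _).trans ?_)
  refine Nat.add_le_add ((Finset.card_union_le _ _).trans (by simp)) ?_
  rw [mul_comm]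
  refine Finset.card_biUnion_le_card_mul _ _ c fun i hi => ?_
  exact h i (Finset.mem_filter.1 hi).1 (Finset.mem_filter.1 hi).2

open Classical in
/-- If some edge at `v` has no other vertex on an edge that avoids `v`, this edge is put into the
matching; otherwise each edge at `v` has at most one vertex besides `v` that gets lost. -/
lemma VertexInvariant.insert_vertex [Fintype β] (hF : ∀ i, (F i).card ≤ 3) (hT : VertexInvariant F T)
    (hv : 1 ≤ liveDeg F T v) (hv2 : 2 ≤ liveDeg F T v ∨ ∀ u, liveDeg F T u ≤ 1) :
    VertexInvariant F (insert v T) := by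
  obtain ⟨P, hP, hPT, hc⟩ := hT
  have hal := card_alive_insert (F := F) (v := v) (T := T)
  have hins := Finset.card_insert_le v T
  have herase : ∀ i, v ∈ F i → ((F i).erase v).card ≤ 2 := fun i hi => by
    rw [Finset.card_erase_of_mem hi]
    have := hF i
    omega
  by_cases hleaf : ∃ i ∈ alive F T, v ∈ F i ∧ Disjoint ((F i).erase v) (liveVerts F (insert v T))
  · obtain ⟨i, hi, hvi, hd⟩ := hleaf
    have hiP : i ∉ P := fun hm =>
      Finset.disjoint_left.1 (hPT i hm i hi) hvi hvi
    have hisolated : ∀ j ∈ alive F (insert v T), Disjoint (F i) (F j) := by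
      intro j hj
      refine Finset.disjoint_left.2 fun u hui huj => ?_
      by_cases huv : u = v
      · subst huv
        rw [alive_insert] at hj
        exact (Finset.mem_filter.1 hj).2 huj
      · exact Finset.disjoint_left.1 hd (Finset.mem_erase.2 ⟨huv, hui⟩)
          (Finset.mem_filter.2 ⟨Finset.mem_univ _, j, hj, huj⟩)
    have hnz := card_liveVerts_le (F := F) (T := T) (v := v) (c := 2) fun j _ hvj =>
      (Finset.card_le_card Finset.sdiff_subset).trans (herase j hvj)
    refine ⟨insert i P, ?_, ?_, ?_⟩
    · rw [Finset.coe_insert]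
      have : Std.Symm fun i j => Disjoint (F i) (F j) := ⟨fun _ _ h => h.symm⟩
      exact Set.pairwise_insert_of_symm.2 ⟨hP, fun j hj _ => (hPT j hj i hi).symm⟩
    · intro a ha j hj
      rcases Finset.mem_insert.1 ha with rfl | ha
      · exact hisolated j hj
      · exact hPT a ha j (alive_anti (Finset.subset_insert _ _) hj)
    · rw [Finset.card_insert_of_notMem hiP]
      omega
  · push Not at hleaf
    -- If all degrees are at most 1, then the edges that avoid `v` avoid every edge at `v`.
    have hdeg : 2 ≤ liveDeg F T v := by
      refine hv2.resolve_right fun hone => ?_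
      obtain ⟨i, hi⟩ := Finset.card_pos.1 hv
      obtain ⟨hiT, hvi⟩ := Finset.mem_filter.1 hi
      obtain ⟨u, hu, hul⟩ := Finset.not_disjoint_iff.1 (hleaf i hiT hvi)
      obtain ⟨j, hj, huj⟩ := (Finset.mem_filter.1 hul).2
      rw [alive_insert, Finset.mem_filter] at hj
      have hij : i = j := Finset.card_le_one.1 (hone u) i
        (Finset.mem_filter.2 ⟨hiT, (Finset.mem_erase.1 hu).2⟩) j
        (Finset.mem_filter.2 ⟨hj.1, huj⟩)
      exact hj.2 (hij ▸ hvi)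
    have hnz := card_liveVerts_le (F := F) (T := T) (v := v) (c := 1) fun i hi hvi => by
      obtain ⟨u, hu, hul⟩ := Finset.not_disjoint_iff.1 (hleaf i hi hvi)
      have hinter := Finset.card_pos.2 ⟨u, Finset.mem_inter.2 ⟨hu, hul⟩⟩
      have hsum := Finset.card_sdiff_add_card_inter ((F i).erase v) (liveVerts F (insert v T))
      have := herase i hvi
      omega
    exact ⟨P, hP, fun i hi j hj => hPT i hi j (alive_anti (Finset.subset_insert _ _) hj),
      by omega⟩

/-- The greedy transversal when there are at least twice as many vertices as edges. -/
lemma card_greedy_le_of_two_mul_le [Fintype β] (hl : ∀ v, v ∈ l) (hF : ∀ i, (F i).card ≤ 3)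
    (hne : ∀ i, (F i).Nonempty) (hcov : ∀ v, ∃ i, v ∈ F i)
    {N : ℕ} (hN : ∀ P : Finset ι, ((P : Set ι).Pairwise fun i j => Disjoint (F i) (F j)) →
      P.card ≤ N) (hm : 2 * Fintype.card ι ≤ Fintype.card β) : (greedy F l).card ≤ 2 * N := by
  classical
  have h0 : VertexInvariant F ∅ := by
    refine ⟨∅, by simp, by simp, ?_⟩
    have : liveVerts F ∅ = Finset.univ := by
      ext v
      simpa [liveVerts] using hcov v
    simpa [this, Finset.card_univ] using hm
  have h3 : VertexInvariant F (greedyPass F 3 l ∅) :=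
    greedyPass_induction h0 fun T v hT hv => hT.insert_vertex hF (by omega) (.inl (by omega))
  have h2 : VertexInvariant F (greedyPass F 2 l (greedyPass F 3 l ∅)) :=
    greedyPass_induction h3 fun T v hT hv => hT.insert_vertex hF (by omega) (.inl (by omega))
  have hone : ∀ v, liveDeg F (greedyPass F 2 l (greedyPass F 3 l ∅)) v ≤ 1 := fun v =>
    Nat.le_of_lt_succ (liveDeg_greedyPass_lt (by norm_num) (hl v))
  have h1 : VertexInvariant F (greedy F l) :=
    (greedyPass_induction (Q := fun T => VertexInvariant F T ∧ ∀ v, liveDeg F T v ≤ 1)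
      ⟨h2, hone⟩ fun T v hT hv => ⟨hT.1.insert_vertex hF hv (.inr hT.2), fun u =>
        (liveDeg_anti (Finset.subset_insert _ _)).trans (hT.2 u)⟩).1
  obtain ⟨P, hP, -, hc⟩ := h1
  have halive : ∀ i, i ∉ alive F (greedy F l) := fun i hi =>
    not_disjoint_greedy hl hne i (mem_alive.1 hi)
  have hverts : liveVerts F (greedy F l) = ∅ := by
    ext v
    simp only [liveVerts, Finset.mem_filter, Finset.notMem_empty, iff_false]
    rintro ⟨-, i, hi, -⟩
    exact halive i hi
  rw [hverts, Finset.card_empty] at hc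
  have := hN P hP
  omega

end GreedyTransversal

/-! ### Reasoning about programs -/

namespace RAM

/-- Started in `s`, the program `P` halts after at most `T` steps in a state that satisfies `Q`. -/
def Ends (P : Prog) (s : State) (T : ℕ) (Q : State → Prop) : Prop :=
  ∃ (t : ℕ) (s' : State), Exec P s t s' ∧ t ≤ T ∧ Q s'

namespace Ends

variable {P R : Prog} {s : State} {T T' : ℕ} {Q Q' : State → Prop}

lemma mono (h : Ends P s T Q) (hT : T ≤ T') (hQ : ∀ s, Q s → Q' s) : Ends P s T' Q' := by
  obtain ⟨t, s', he, ht, hq⟩ := h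
  exact ⟨t, s', he, ht.trans hT, hQ _ hq⟩

lemma skip (h : Q s) : Ends .skip s 1 Q := ⟨1, s, .skip s, le_rfl, h⟩

lemma instr {i : Instr} (h : Q (i.exec s)) : Ends (.instr i) s 1 Q :=
  ⟨1, _, .instr i s, le_rfl, h⟩

lemma seq (h : Ends P s T fun s' => Ends R s' T' Q) : Ends (.seq P R) s (T + T') Q := by
  obtain ⟨t, s', he, ht, t', s'', he', ht', hq⟩ := h
  exact ⟨t + t', s'', .seq he he', add_le_add ht ht', hq⟩

lemma ifLt {x y : ℕ} (h₁ : s.reg x < s.reg y → Ends P s T Q)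
    (h₂ : ¬ s.reg x < s.reg y → Ends R s T Q) : Ends (.ifLt x y P R) s (1 + T) Q := by
  by_cases h : s.reg x < s.reg y
  · obtain ⟨t, s', he, ht, hq⟩ := h₁ h
    exact ⟨1 + t, s', .ifTrue h he, by omega, hq⟩
  · obtain ⟨t, s', he, ht, hq⟩ := h₂ h
    exact ⟨1 + t, s', .ifFalse h he, by omega, hq⟩

/-- The rule for a loop that is passed through exactly `N` times; `Inv j` holds after `j` rounds. -/
lemma whileLt {x y N : ℕ} {Inv : ℕ → State → Prop} (h0 : Inv 0 s)
    (hstep : ∀ j < N, ∀ s, Inv j s → s.reg x < s.reg y ∧ Ends P s T (Inv (j + 1)))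
    (hend : ∀ s, Inv N s → ¬ s.reg x < s.reg y) :
    Ends (.whileLt x y P) s (N * (1 + T) + 1) (Inv N) := by
  suffices h : ∀ d ≤ N, ∀ s, Inv (N - d) s →
      Ends (.whileLt x y P) s (d * (1 + T) + 1) (Inv N) from h N le_rfl s (by simpa using h0)
  intro d
  induction d with
  | zero => exact fun _ s hs => ⟨1, s, .whileFalse (hend s hs), by omega, hs⟩
  | succ d ih =>
    intro hd s hs
    obtain ⟨hlt, t, s', he, ht, hq⟩ := hstep _ (by omega) s hs
    rw [show N - (d + 1) + 1 = N - d by omega] at hq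
    obtain ⟨t', s'', he', ht', hq'⟩ := ih (by omega) s' hq
    exact ⟨1 + t + t', s'', .whileTrue hlt he he', by rw [add_mul]; omega, hq'⟩

end Ends

/-- Instructions one after the other. -/
def block (l : List Instr) : Prog := l.foldr (fun i P => .seq (.instr i) P) .skip

lemma Ends.block {l : List Instr} {s : State} {Q : State → Prop}
    (h : Q (l.foldl (fun s i => i.exec s) s)) : Ends (block l) s (l.length + 1) Q := by
  induction l generalizing s with
  | nil => exact .skip h
  | cons i l ih =>
    rw [List.length_cons, add_right_comm, add_comm]
    exact .seq (.instr (ih h))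

/-! ### The program -/

/-- Add 1 to register 6 if edge number `reg 7` contains the vertex marked in array 2 and none that
is marked in array 1. Register 8 is `3 * reg 7`, register 2 is 0 and register 3 is 1. -/
def countBody : Prog :=
  .seq (block [.load 9 0 8, .add 8 8 3, .load 10 0 8, .add 8 8 3, .load 11 0 8, .add 8 8 3,
      .add 7 7 3, .load 12 1 9, .load 13 1 10, .add 12 12 13, .load 13 1 11, .add 12 12 13,
      .load 14 2 9, .load 13 2 10, .add 14 14 13, .load 13 2 11, .add 14 14 13])
    (.ifLt 2 12 .skip (.ifLt 2 14 (.instr (.add 6 6 3)) .skip))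

/-- Compute the number of edges at vertex `reg 5` that are not met yet, and mark this vertex in
array 1 if this number is at least `reg 4`. -/
def stepBody : Prog :=
  .seq (block [.const 6 0, .const 7 0, .const 8 0, .store 2 5 3])
    (.seq (.whileLt 7 1 countBody)
      (.seq (.ifLt 6 4 .skip (.instr (.store 1 5 3)))
        (block [.store 2 5 2, .add 5 5 3])))

/-- The pass with threshold `k`. -/
def passProg (k : ℕ) : Prog :=
  .seq (block [.const 3 1, .const 4 k, .const 5 0]) (.whileLt 5 0 stepBody)

/-- The greedy algorithm. -/
def greedyProg : Prog := .seq (passProg 3) (.seq (passProg 2) (passProg 1))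

/-- Edge number `j`, in array 0, has no vertex marked in array 1, but one marked in array 2. -/
def Counted (a : ℕ → ℕ → ℕ) (j : ℕ) : Prop :=
  a 1 (a 0 (3 * j)) + a 1 (a 0 (3 * j + 1)) + a 1 (a 0 (3 * j + 2)) = 0 ∧
    0 < a 2 (a 0 (3 * j)) + a 2 (a 0 (3 * j + 1)) + a 2 (a 0 (3 * j + 2))

instance (a : ℕ → ℕ → ℕ) : DecidablePred (Counted a) := fun _ => by
  unfold Counted
  infer_instance

/-- The registers that are constant during a pass with threshold `k`. -/
structure PassRegs (n m k : ℕ) (s : State) : Prop where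
  reg0 : s.reg 0 = n
  reg1 : s.reg 1 = m
  reg2 : s.reg 2 = 0
  reg3 : s.reg 3 = 1
  reg4 : s.reg 4 = k

/-- The invariant of the counting loop, after `i` edges. -/
structure CountInv (n m k v : ℕ) (a : ℕ → ℕ → ℕ) (i : ℕ) (s : State) : Prop
    extends PassRegs n m k s where
  reg5 : s.reg 5 = v
  reg6 : s.reg 6 = ((Finset.range i).filter (Counted a)).card
  reg7 : s.reg 7 = i
  reg8 : s.reg 8 = 3 * i
  arr : s.arr = a

lemma ends_countBody {n m k v i : ℕ} {a : ℕ → ℕ → ℕ} {s : State} (h : CountInv n m k v a i s) :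
    Ends countBody s 21 (CountInv n m k v a (i + 1)) := by
  obtain ⟨⟨h0, h1, h2, h3, h4⟩, h5, h6, h7, h8, ha⟩ := h
  refine .seq (T := 18) (T' := 3) (.block ?_)
  have hcard : ((Finset.range (i + 1)).filter (Counted a)).card =
      ((Finset.range i).filter (Counted a)).card + if Counted a i then 1 else 0 := by
    rw [Finset.card_filter, Finset.card_filter, Finset.sum_range_succ]
  simp only [List.foldl_cons, List.foldl_nil, Instr.exec, State.setReg, Function.update_apply]
  refine Ends.ifLt (T := 2) (fun hlt => (Ends.skip ?_).mono (by norm_num) fun _ h => h)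
    (fun hlt => .ifLt (T := 1) (fun hlt' => .instr ?_) fun hlt' => .skip ?_)
  all_goals simp [h2, h8, h3, ha] at hlt
  · have hC : ¬ Counted a i := fun hC => by
      have := hC.1
      simp only [add_assoc, Nat.reduceAdd] at hlt this
      omega
    constructor
    · constructor <;> simp [*]
    all_goals simp [*]
    ring
  · simp [h2, h8, h3, ha] at hlt'
    have hC : Counted a i := by
      simp only [add_assoc, Nat.reduceAdd, Counted] at hlt hlt' ⊢
      omega
    constructor
    · constructor <;> simp [*, Instr.exec, State.setReg]
    all_goals simp [*, Instr.exec, State.setReg]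
    ring
  · simp [h2, h8, h3, ha] at hlt'
    have hC : ¬ Counted a i := fun hC => by
      have := hC.2
      simp only [add_assoc, Nat.reduceAdd] at hlt' this
      omega
    constructor
    · constructor <;> simp [*]
    all_goals simp [*]
    ring

open GreedyTransversal

variable {n m : ℕ} {e : Fin m → Fin 3 → Fin n}

/-- The edges as finite sets of vertex numbers. -/
def edges (e : Fin m → Fin 3 → Fin n) (i : Fin m) : Finset (Fin n) := Finset.univ.image (e i)

lemma disjoint_edges {i : Fin m} {T : Finset (Fin n)} :
    Disjoint (edges e i) T ↔ e i 0 ∉ T ∧ e i 1 ∉ T ∧ e i 2 ∉ T := by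
  rw [edges, Finset.disjoint_left, Finset.forall_mem_image]
  simp [Fin.forall_fin_succ]

lemma mem_edges {i : Fin m} {v : Fin n} : v ∈ edges e i ↔ e i 0 = v ∨ e i 1 = v ∨ e i 2 = v := by
  simp [edges, Fin.exists_fin_succ]

lemma inputState_arr (i : Fin m) (c : Fin 3) :
    (inputState e).arr 0 (3 * i + c) = e i c := by
  have hlt : 3 * (i : ℕ) + c < 3 * m := by omega
  have h1 : (3 * (i : ℕ) + c) / 3 = i := by omega
  have h2 : (3 * (i : ℕ) + c) % 3 = c := by omega
  simp [inputState, hlt, h1, h2]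

lemma card_counted {a : ℕ → ℕ → ℕ} {T : Finset (Fin n)} {v : Fin n}
    (h0 : a 0 = (inputState e).arr 0) (h1 : ∀ v : Fin n, a 1 v ≠ 0 ↔ v ∈ T)
    (h2 : a 2 = Function.update (fun _ => 0) (v : ℕ) 1) :
    ((Finset.range m).filter (Counted a)).card = liveDeg (edges e) T v := by
  classical
  rw [liveDeg, alive, Finset.filter_filter, Finset.card_filter, Finset.card_filter,
    ← Fin.sum_univ_eq_sum_range (fun i => if Counted a i then 1 else 0)]
  refine Finset.sum_congr rfl fun i _ => ?_
  congr 1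
  have e0 := inputState_arr (e := e) i 0
  have e1 := inputState_arr (e := e) i 1
  have e2 := inputState_arr (e := e) i 2
  simp only [Fin.val_zero, add_zero, Fin.val_one, Fin.val_two] at e0 e1 e2
  have hpos : ∀ w : Fin n, 0 < a 2 w ↔ w = v := fun w => by
    by_cases hw : w = v <;> simp [h2, hw, Fin.val_inj]
  have hzero : ∀ w : Fin n, a 1 w = 0 ↔ w ∉ T := fun w => by rw [← h1 w, not_not]
  simp only [Counted, h0, e0, e1, e2, Nat.add_eq_zero_iff, Nat.add_pos_iff_pos_or_pos, hpos, hzero,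
    disjoint_edges, mem_edges, and_assoc, or_assoc]

/-- The invariant of the main loop, when `T` is the set marked in array 1 and `v` is the next
vertex. -/
structure PassInv (e : Fin m → Fin 3 → Fin n) (k : ℕ) (T : Finset (Fin n)) (v : ℕ) (s : State) :
    Prop extends PassRegs n m k s where
  reg5 : s.reg 5 = v
  arr0 : s.arr 0 = (inputState e).arr 0
  arr1 : ∀ v : Fin n, s.arr 1 v ≠ 0 ↔ v ∈ T
  arr2 : s.arr 2 = fun _ => 0

lemma ends_stepBody {k : ℕ} {T : Finset (Fin n)} {v : Fin n} {s : State}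
    (h : PassInv e k T v s) :
    Ends stepBody s (m * 22 + 11) (PassInv e k (greedyStep (edges e) k T v) (v + 1)) := by
  obtain ⟨⟨h0, h1, h2, h3, h4⟩, h5, ha0, ha1, ha2⟩ := h
  let a := Function.update s.arr 2 (Function.update (fun _ => 0) v 1)
  have hT : m * 22 + 11 = 5 + ((m * (1 + 21) + 1) + (2 + 3)) := by ring
  rw [hT]
  refine .seq (.block ?_)
  refine .seq ((Ends.whileLt (N := m) (Inv := CountInv n m k v a) (T := 21) ?_ ?_ ?_).mono le_rfl ?_)
  · constructor
    · constructor <;> simp [Instr.exec, State.setReg, State.setArr, *]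
    all_goals simp [Instr.exec, State.setReg, State.setArr, a, *]
  · exact fun j hj s hs => ⟨by rw [hs.reg7, hs.reg1]; exact hj, ends_countBody hs⟩
  · exact fun s hs => by rw [hs.reg7, hs.reg1]; exact lt_irrefl m
  intro s' hs'
  have hcount : s'.reg 6 = liveDeg (edges e) T v := by
    rw [hs'.reg6]
    exact card_counted (by simp [a, ha0]) (by simpa [a] using ha1) (by simp [a])
  obtain ⟨⟨g0, g1, g2, g3, g4⟩, g5, g6, g7, g8, ga⟩ := hs'
  refine .seq (.ifLt (T := 1) (fun hlt => .skip (.block ?_)) fun hlt => .instr (.block ?_))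
  · have hstep : greedyStep (edges e) k T v = T := if_neg (by omega)
    rw [hstep]
    constructor
    · constructor <;> simp [Instr.exec, State.setReg, State.setArr, *]
    all_goals simp [Instr.exec, State.setReg, State.setArr, *, a]
  · have hstep : greedyStep (edges e) k T v = insert v T := by
      rw [greedyStep, if_pos (by omega)]
      ext
      simp
    rw [hstep]
    constructor
    · constructor <;> simp [Instr.exec, State.setReg, State.setArr, *]
    all_goals simp [Instr.exec, State.setReg, State.setArr, *, a]
    intro w
    rw [← ha1 w]
    by_cases hw : w = v <;> simp [hw, Fin.val_inj]

lemma ends_passProg (k : ℕ) {T : Finset (Fin n)} {s : State} (h0 : s.reg 0 = n) (h1 : s.reg 1 = m)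
    (h2 : s.reg 2 = 0) (ha0 : s.arr 0 = (inputState e).arr 0)
    (ha1 : ∀ v : Fin n, s.arr 1 v ≠ 0 ↔ v ∈ T) (ha2 : s.arr 2 = fun _ => 0) :
    Ends (passProg k) s (n * (m * 22 + 12) + 5)
      (PassInv e k (greedyPass (edges e) k (List.finRange n) T) n) := by
  have hT : n * (m * 22 + 12) + 5 = 4 + (n * (1 + (m * 22 + 11)) + 1) := by ring
  rw [hT]
  refine .seq (.block ?_)
  refine (Ends.whileLt (N := n) (T := m * 22 + 11) (Inv := fun j =>
    PassInv e k (greedyPass (edges e) k ((List.finRange n).take j) T) j) ?_ ?_ ?_).mono le_rfl ?_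
  · constructor
    · constructor <;> simp [Instr.exec, State.setReg, *]
    all_goals simp [Instr.exec, State.setReg, greedyPass, *]
  · intro j hj s hs
    refine ⟨by rw [hs.reg5, hs.reg0]; exact hj, ?_⟩
    have htake : (List.finRange n).take (j + 1) = (List.finRange n).take j ++ [⟨j, hj⟩] := by
      rw [List.take_add_one]
      simp [hj]
    rw [htake, greedyPass, List.foldl_append]
    exact ends_stepBody (v := ⟨j, hj⟩) hs
  · exact fun s hs => by rw [hs.reg5, hs.reg0]; exact lt_irrefl n
  · intro s hs
    rwa [List.take_of_length_le (by simp)] at hs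

lemma ends_greedyProg (e : Fin m → Fin 3 → Fin n) :
    Ends greedyProg (inputState e) (3 * (n * (m * 22 + 12) + 5))
      fun s => ∀ v : Fin n, s.arr 1 v ≠ 0 ↔ v ∈ greedy (edges e) (List.finRange n) := by
  rw [show ∀ t, 3 * t = t + (t + t) by intro t; ring]
  refine .seq ((ends_passProg 3 (e := e) (T := ∅) rfl rfl rfl rfl ?_ ?_).mono le_rfl fun s hs => ?_)
  · simp [inputState]
  · simp [inputState]
  refine .seq ((ends_passProg 2 hs.reg0 hs.reg1 hs.reg2 hs.arr0 hs.arr1 hs.arr2).mono le_rfl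
    fun s hs => ?_)
  exact (ends_passProg 1 hs.reg0 hs.reg1 hs.reg2 hs.arr0 hs.arr1 hs.arr2).mono le_rfl
    fun s hs => hs.arr1

end RAM

/-! ### Hypergraphs and their presentations -/

namespace Hypergraph

variable {α : Type*} {H : Hypergraph α} {n m : ℕ} {lab : Fin n → α} {e : Fin m → Fin 3 → Fin n}

lemma IsPresentation.ncard_vertexSet (h : H.IsPresentation lab e) : V(H).ncard = n := by
  rw [← h.range_lab, ← Set.image_univ, Set.ncard_image_of_injective _ h.lab_injective]
  simp

lemma IsPresentation.ncard_edgeSet (h : H.IsPresentation lab e) : E(H).ncard = m := by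
  rw [← h.range_edge, ← Set.image_univ, Set.ncard_image_of_injective _ h.edge_injective]
  simp

lemma IsPresentation.card_le_matchingNumber (h : H.IsPresentation lab e) (P : Finset (Fin m))
    (hP : (P : Set (Fin m)).Pairwise fun i j => Disjoint (RAM.edges e i) (RAM.edges e j)) :
    P.card ≤ H.matchingNumber := by
  have hfin : E(H).Finite := by
    rw [← h.range_edge]
    exact Set.finite_range _
  refine le_csSup ⟨E(H).ncard, ?_⟩ ⟨(fun i => lab '' Set.range (e i)) '' P, ⟨?_, ?_⟩, ?_⟩
  · rintro _ ⟨M, hM, rfl⟩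
    exact Set.ncard_le_ncard hM.1 hfin
  · rw [← h.range_edge]
    exact Set.image_subset_range _ _
  · rintro _ ⟨i, hi, rfl⟩ _ ⟨j, hj, rfl⟩ hij
    have hd := Finset.disjoint_coe.2 (hP hi hj fun hij' => hij (by rw [hij']))
    simpa [RAM.edges, Set.disjoint_image_iff h.lab_injective] using hd
  · rw [Set.ncard_image_of_injective _ h.edge_injective, Set.ncard_coe_finset]

/-- Every finite 3-uniform hypergraph can be given to the machine. -/
lemma exists_isPresentation (hV : V(H).Finite) (h3 : H.IsUniform 3) :
    ∃ (n m : ℕ) (lab : Fin n → α) (e : Fin m → Fin 3 → Fin n), H.IsPresentation lab e := by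
  have hE : E(H).Finite := hV.powerset.subset H.edgeSet_subset_powerset_vertexSet
  have := hV.to_subtype
  have := hE.to_subtype
  obtain ⟨n, ⟨f⟩⟩ := Finite.exists_equiv_fin V(H)
  obtain ⟨m, ⟨g⟩⟩ := Finite.exists_equiv_fin E(H)
  have hrange : ∀ i, ∃ t : Fin 3 → Fin n,
      (fun x => (f.symm x : α)) '' Set.range t = (g.symm i : Set α) := by
    intro i
    obtain ⟨x, y, z, -, -, -, hxyz⟩ := Set.encard_eq_three.1 (h3 _ (g.symm i).2)
    have hsub : ∀ w ∈ ({x, y, z} : Set α), w ∈ V(H) := fun w hw =>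
      H.mem_vertexSet_of_mem_edgeSet (g.symm i).2 (hxyz ▸ hw)
    refine ⟨![f ⟨x, hsub x (by simp)⟩, f ⟨y, hsub y (by simp)⟩, f ⟨z, hsub z (by simp)⟩], ?_⟩
    rw [hxyz]
    simp only [Matrix.range_cons, Matrix.range_empty, Set.union_empty, Set.singleton_union,
      Set.image_insert_eq, Set.image_singleton, Equiv.symm_apply_apply]
  choose e he using hrange
  refine ⟨n, m, fun x => f.symm x, e, Subtype.val_injective.comp f.symm.injective, ?_, ?_, ?_⟩
  · rw [Set.range_comp' Subtype.val, f.symm.surjective.range_eq, Set.image_univ, Subtype.range_coe]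
  · intro i j hij
    simp only [he] at hij
    exact g.symm.injective (Subtype.ext hij)
  · simp only [he]
    rw [Set.range_comp' Subtype.val, g.symm.surjective.range_eq, Set.image_univ, Subtype.range_coe]

lemma IsPresentation.card_greedy_le (h : H.IsPresentation lab e)
    (hiso : ∀ v ∈ V(H), ¬ H.IsIsolated v)
    (hor : (1 / 3 : ℚ) ≤ (H.matchingNumber : ℚ) / (E(H).ncard : ℚ) ∨
      (2 : ℚ) ≤ (V(H).ncard : ℚ) / (E(H).ncard : ℚ)) :
    (GreedyTransversal.greedy (RAM.edges e) (List.finRange n)).card ≤ 2 * H.matchingNumber := by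
  rw [h.ncard_vertexSet, h.ncard_edgeSet] at hor
  have hl : ∀ v, v ∈ List.finRange n := List.mem_finRange
  have hF : ∀ i, (RAM.edges e i).card ≤ 3 := fun i => Finset.card_image_le.trans (by simp)
  rcases Nat.eq_zero_or_pos m with rfl | hm
  · norm_num at hor
  have hm' : (0 : ℚ) < m := by exact_mod_cast hm
  rcases hor with hor | hor
  · refine GreedyTransversal.card_greedy_le_of_card_le hl hF h.card_le_matchingNumber ?_
    rw [div_le_div_iff₀ (by norm_num) hm', one_mul] at hor
    rw [Fintype.card_fin, mul_comm]
    exact_mod_cast hor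
  · refine GreedyTransversal.card_greedy_le_of_two_mul_le hl hF ?_ ?_ h.card_le_matchingNumber ?_
    · exact fun i => ⟨e i 0, by simp [RAM.mem_edges]⟩
    · intro v
      have hv : lab v ∈ V(H) := h.range_lab ▸ Set.mem_range_self v
      have hniso := hiso _ hv
      simp only [IsIsolated, not_forall, not_not] at hniso
      obtain ⟨f, hf, hvf⟩ := hniso
      rw [← h.range_edge] at hf
      obtain ⟨i, rfl⟩ := hf
      exact ⟨i, by simpa [RAM.edges, h.lab_injective.eq_iff] using hvf⟩
    · rw [le_div_iff₀ hm'] at hor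
      rw [Fintype.card_fin, Fintype.card_fin]
      exact_mod_cast hor

lemma IsPresentation.isTransversal_greedy (h : H.IsPresentation lab e) :
    H.IsTransversal (lab '' (GreedyTransversal.greedy (RAM.edges e) (List.finRange n) :
      Set (Fin n))) := by
  refine ⟨h.range_lab ▸ Set.image_subset_range _ _, ?_⟩
  rw [← h.range_edge]
  rintro _ ⟨i, rfl⟩
  obtain ⟨v, hvi, hv⟩ := Finset.not_disjoint_iff.1 (GreedyTransversal.not_disjoint_greedy
    (F := RAM.edges e) List.mem_finRange (fun i => ⟨e i 0, by simp [RAM.mem_edges]⟩) i)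
  exact ⟨lab v, Set.mem_image_of_mem _ hv, Set.mem_image_of_mem _ (by simpa [RAM.edges] using hvi)⟩

end Hypergraph

theorem mainTheorem6 :
    ∃ (P : RAM.Prog) (p : Polynomial ℕ),
      ∀ (α : Type u) (H : Hypergraph α),
        V(H).Finite →
        H.IsUniform 3 →
        H.IsLinear →
        (∀ v ∈ V(H), ¬ H.IsIsolated v) →
        ((1 / 3 : ℚ) ≤ (H.matchingNumber : ℚ) / (E(H).ncard : ℚ) ∨
          (2 : ℚ) ≤ (V(H).ncard : ℚ) / (E(H).ncard : ℚ)) →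
        (∀ (n m : ℕ) (lab : Fin n → α) (e : Fin m → Fin 3 → Fin n),
          H.IsPresentation lab e →
          ∃ (t : ℕ) (s : RAM.State),
            RAM.Exec P (RAM.inputState e) t s ∧
            t ≤ p.eval (n + m) ∧
            H.IsTransversal (lab '' RAM.outputSet n s) ∧
            (lab '' RAM.outputSet n s).ncard ≤ 2 * H.matchingNumber) ∧
        H.transversalNumber ≤ 2 * H.matchingNumber := by
  refine ⟨RAM.greedyProg, 66 * (Polynomial.X + 1) ^ 2, fun α H hV h3 _ hiso hor => ?_⟩
  have hsmall : ∀ (n m : ℕ) (lab : Fin n → α) (e : Fin m → Fin 3 → Fin n),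
      H.IsPresentation lab e →
      (lab '' (GreedyTransversal.greedy (RAM.edges e) (List.finRange n) : Set (Fin n))).ncard ≤
        2 * H.matchingNumber := fun n m lab e h => by
    rw [Set.ncard_image_of_injective _ h.lab_injective, Set.ncard_coe_finset]
    exact h.card_greedy_le hiso hor
  refine ⟨fun n m lab e h => ?_, ?_⟩
  · obtain ⟨t, s, he, ht, hs⟩ := RAM.ends_greedyProg e
    have hout : RAM.outputSet n s =
        (GreedyTransversal.greedy (RAM.edges e) (List.finRange n) : Set (Fin n)) :=
      Set.ext hs
    refine ⟨t, s, he, ht.trans ?_, ?_, ?_⟩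
    · simp only [Polynomial.eval_mul, Polynomial.eval_pow, Polynomial.eval_add, Polynomial.eval_X,
        Polynomial.eval_one, Polynomial.eval_ofNat]
      nlinarith [Nat.zero_le (n * m), Nat.zero_le (n * n), Nat.zero_le (m * m)]
    · exact hout ▸ h.isTransversal_greedy
    · exact hout ▸ hsmall n m lab e h
  · obtain ⟨n, m, lab, e, h⟩ := Hypergraph.exists_isPresentation hV h3
    exact (Nat.sInf_le (s := {k | ∃ T : Set α, H.IsTransversal T ∧ T.ncard = k})
      ⟨_, h.isTransversal_greedy, rfl⟩).trans (hsmall n m lab e h)
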